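/- Let $K$ and $L$ be number fields whose Dedekind zeta functions coincide, $\zeta_K(s)=\zeta_L(s)$ (equivalently, $\zeta_K(s)=\zeta_L(s)$ for all $s\in\mathbb{C}$ with $\operatorname{Re}(s)>1$, where $\zeta_E(s)=\sum_{n\ge 1}\#\{I\subseteq \mathcal{O}_E \text{ an ideal of norm } n\}\,n^{-s}$). Then $K$ and $L$ have the same Galois closure over $\mathbb{Q}$: $\widetilde{K}=\widetilde{L}$. Here, for a number field $E$, $\widetilde{E}$ denotes the Galois closure of $E$ over $\mathbb{Q}$ inside a fixed algebraically closed field $\Omega$ of characteristic zero (for instance $\Omega=\overline{\mathbb{Q}}$ or $\Omega=\mathbb{C}$), that is, the subfield of $\Omega$ generated by the images of all embeddings $E\hookrightarrow\Omega$. -/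

import Mathlib

open NumberField Ideal UniqueFactorizationMonoid

/-! The zeta function determines its Dirichlet coefficients, the ideal counts. For a prime `p`, the
number of ideals of norm `p` is at most the degree, with equality exactly when `p` splits
completely. Every number field has a completely split prime (take one for its Galois closure), so
equal counts force equal degrees, hence the same completely split primes
(`SplitsCompletely.of_idealCount_eq`).

Let `F` be the Galois closure of `K` and `M` the compositum of `F` with that of `L`. A prime split
in `F` splits in `K`, hence in `L`, and so, with finitely many exceptions, in `M`, which is
generated by conjugates of `K` and `L`.

A density estimate then bounds degrees. As `s` decreases to 1, the split primes of any `M` satisfy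
`[M:ℚ] ∑ p^(-s) ≤ -log (s - 1) + O(1)`, while for Galois `F` the reverse inequality holds too, since
unramified primes of degree one lie over split `p`. Hence `[M:ℚ] ≤ [F:ℚ]`
(`finrank_le_of_splitsCompletely`), so `M = F` contains the closure of `L`. Symmetry finishes. -/

/-- The rational prime `p` splits completely in `F`: the `p`-power map is the identity
on `𝓞 F / p`. -/
def SplitsCompletely (F : Type*) [Field F] (p : ℕ) : Prop :=
  ∀ x : 𝓞 F, (p : 𝓞 F) ∣ x ^ p - x

/-- The number of integral ideals of norm `n`. -/
noncomputable def idealCount (F : Type*) [Field F] [NumberField F] (n : ℕ) : ℕ :=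
  Nat.card {I : Ideal (𝓞 F) // absNorm I = n}

open scoped Classical in
/-- The finite set of prime ideals of `𝓞 F` that contain the natural number `p`. -/
noncomputable def primesAbove (F : Type*) [Field F] [NumberField F] (p : ℕ) :
    Finset (Ideal (𝓞 F)) :=
  (normalizedFactors (span {(p : 𝓞 F)})).toFinset

/-! ### Ideals of norm `p` and complete splitting -/

section PrimesAbove

variable {F : Type*} [Field F] [NumberField F] {p : ℕ} {P : Ideal (𝓞 F)}

theorem span_natCast_ne_bot (hp : p.Prime) : span {(p : 𝓞 F)} ≠ ⊥ := by
  simpa using hp.ne_zero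

theorem absNorm_span_natCast_eq_pow_finrank (p : ℕ) :
    absNorm (span {(p : 𝓞 F)}) = p ^ Module.finrank ℚ F := by
  rw [absNorm_span_natCast, RingOfIntegers.rank]

theorem mem_primesAbove_iff (hp : p.Prime) :
    P ∈ primesAbove F p ↔ P.IsPrime ∧ (p : 𝓞 F) ∈ P := by
  rw [primesAbove, Multiset.mem_toFinset, Ideal.mem_normalizedFactors_iff (span_natCast_ne_bot hp),
    span_singleton_le_iff_mem]

theorem ne_bot_of_mem_primesAbove (hp : p.Prime) (h : P ∈ primesAbove F p) : P ≠ ⊥ := by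
  rintro rfl
  have := ((mem_primesAbove_iff hp).1 h).2
  exact hp.ne_zero (by simpa using this)

theorem prime_of_mem_primesAbove (hp : p.Prime) (h : P ∈ primesAbove F p) : Prime P :=
  prime_of_isPrime (ne_bot_of_mem_primesAbove hp h) ((mem_primesAbove_iff hp).1 h).1

theorem exists_absNorm_eq_pow_of_mem_primesAbove (hp : p.Prime) (h : P ∈ primesAbove F p) :
    ∃ k, k ≠ 0 ∧ absNorm P = p ^ k := by
  have hd : absNorm P ∣ p ^ Module.finrank ℚ F := by
    rw [← absNorm_span_natCast_eq_pow_finrank]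
    exact absNorm_dvd_absNorm_of_le
      ((span_singleton_le_iff_mem _).2 ((mem_primesAbove_iff hp).1 h).2)
  obtain ⟨k, -, hk⟩ := (Nat.dvd_prime_pow hp).1 hd
  refine ⟨k, ?_, hk⟩
  rintro rfl
  exact ((mem_primesAbove_iff hp).1 h).1.ne_top (absNorm_eq_one_iff.1 (by simpa using hk))

theorem le_absNorm_of_mem_primesAbove (hp : p.Prime) (h : P ∈ primesAbove F p) :
    p ≤ absNorm P := by
  obtain ⟨k, hk, hP⟩ := exists_absNorm_eq_pow_of_mem_primesAbove hp h
  exact hP ▸ Nat.le_self_pow hk p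

theorem absNorm_eq_or_sq_le_of_mem_primesAbove (hp : p.Prime) (h : P ∈ primesAbove F p) :
    absNorm P = p ∨ p ^ 2 ≤ absNorm P := by
  obtain ⟨k, hk, hP⟩ := exists_absNorm_eq_pow_of_mem_primesAbove hp h
  rcases Nat.lt_or_ge k 2 with h2 | h2
  · left; rw [hP, show k = 1 by omega, pow_one]
  · right; rw [hP]; exact Nat.pow_le_pow_right hp.pos h2

theorem prod_dvd_of_subset_primesAbove (hp : p.Prime) {A : Finset (Ideal (𝓞 F))}
    (hA : A ⊆ primesAbove F p) {I : Ideal (𝓞 F)} (hI : ∀ P ∈ A, I ≤ P) : ∏ P ∈ A, P ∣ I :=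
  Finset.prod_primes_dvd _ (fun _ h => prime_of_mem_primesAbove hp (hA h))
    (fun P h => Ideal.dvd_iff_le.2 (hI P h))

theorem span_le_of_mem_primesAbove (hp : p.Prime) (h : P ∈ primesAbove F p) :
    span {(p : 𝓞 F)} ≤ P :=
  (span_singleton_le_iff_mem _).2 ((mem_primesAbove_iff hp).1 h).2

/-- The product of the distinct primes above `p` divides `(p)`, and each has norm at least `p`;
compare norms. -/
theorem card_primesAbove_le (hp : p.Prime) :
    (primesAbove F p).card ≤ Module.finrank ℚ F := by
  have h1 : ∏ P ∈ primesAbove F p, absNorm P ∣ p ^ Module.finrank ℚ F := by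
    rw [← map_prod, ← absNorm_span_natCast_eq_pow_finrank]
    exact absNorm_dvd_absNorm_of_le (Ideal.dvd_iff_le.1 (prod_dvd_of_subset_primesAbove hp
      subset_rfl fun P h => span_le_of_mem_primesAbove hp h))
  have h2 : p ^ (primesAbove F p).card ≤ ∏ P ∈ primesAbove F p, absNorm P :=
    Finset.pow_card_le_prod _ _ _ fun P h => le_absNorm_of_mem_primesAbove hp h
  exact (Nat.pow_le_pow_iff_right hp.one_lt).1
    (h2.trans (Nat.le_of_dvd (pow_pos hp.pos _) h1))

theorem mem_primesAbove_of_absNorm_eq (hp : p.Prime) (h : absNorm P = p) :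
    P ∈ primesAbove F p := by
  rw [mem_primesAbove_iff hp]
  exact ⟨isPrime_of_irreducible_absNorm (h ▸ hp), h ▸ absNorm_mem P⟩

theorem idealCount_eq_card_filter (hp : p.Prime) :
    idealCount F p = ((primesAbove F p).filter fun P => absNorm P = p).card := by
  rw [idealCount, ← Nat.card_eq_finsetCard]
  refine Nat.card_congr (Equiv.subtypeEquivRight fun I => ?_)
  simp only [Finset.mem_filter]
  exact ⟨fun h => ⟨mem_primesAbove_of_absNorm_eq hp h, h⟩, fun h => h.2⟩

theorem idealCount_le_finrank (hp : p.Prime) : idealCount F p ≤ Module.finrank ℚ F := by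
  rw [idealCount_eq_card_filter hp]
  exact (Finset.card_filter_le _ _).trans (card_primesAbove_le hp)

theorem pow_sub_self_mem_of_absNorm_eq (hp : p.Prime) (h : absNorm P = p) (x : 𝓞 F) :
    x ^ p - x ∈ P := by
  have hP := (mem_primesAbove_iff hp).1 (mem_primesAbove_of_absNorm_eq hp h)
  have := hP.1
  have : P.IsMaximal := hP.1.isMaximal
    (ne_bot_of_mem_primesAbove hp (mem_primesAbove_of_absNorm_eq hp h))
  let _ := Ideal.Quotient.field P
  have hfin : Finite (𝓞 F ⧸ P) := (absNorm_ne_zero_iff P).1 (h ▸ hp.ne_zero)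
  have := Fintype.ofFinite (𝓞 F ⧸ P)
  have hc : Fintype.card (𝓞 F ⧸ P) = p := by
    rw [← Nat.card_eq_fintype_card, ← h]; rfl
  rw [← Ideal.Quotient.eq_zero_iff_mem, map_sub, map_pow, sub_eq_zero]
  conv_lhs => rw [← hc]
  exact FiniteField.pow_card _

/-- The primes of norm `p` have a product dividing `(p)` and of the same norm, hence equal to `(p)`.
Each residue field has `p` elements, so `x ^ p - x` lies in every factor. -/
theorem splitsCompletely_of_idealCount_eq (hp : p.Prime)
    (h : idealCount F p = Module.finrank ℚ F) : SplitsCompletely F p := by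
  set A := (primesAbove F p).filter fun P => absNorm P = p
  have hsub : A ⊆ primesAbove F p := Finset.filter_subset _ _
  have hd : ∏ P ∈ A, P ∣ span {(p : 𝓞 F)} := prod_dvd_of_subset_primesAbove hp hsub
    fun P h => span_le_of_mem_primesAbove hp (hsub h)
  have hN : absNorm (∏ P ∈ A, P) = p ^ Module.finrank ℚ F := by
    rw [map_prod, Finset.prod_congr rfl fun P h => (Finset.mem_filter.1 h).2, Finset.prod_const,
      ← idealCount_eq_card_filter hp, h]
  have heq : ∏ P ∈ A, P = span {(p : 𝓞 F)} := by
    obtain ⟨J, hJ⟩ := hd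
    have h1 := congrArg absNorm hJ
    rw [absNorm_span_natCast_eq_pow_finrank, map_mul, hN] at h1
    have h2 : absNorm J = 1 := by
      have := pow_pos hp.pos (Module.finrank ℚ F)
      exact Nat.eq_of_mul_eq_mul_left this (by rw [← h1, mul_one])
    rw [hJ, absNorm_eq_one_iff.1 h2, Ideal.mul_top]
  intro x
  rw [← mem_span_singleton, ← heq, ← span_singleton_le_iff_mem]
  refine Ideal.dvd_iff_le.1 (prod_dvd_of_subset_primesAbove hp hsub fun P h => ?_)
  rw [span_singleton_le_iff_mem]
  exact pow_sub_self_mem_of_absNorm_eq hp (Finset.mem_filter.1 h).2 x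

/-- Every element of the residue field is a root of `X ^ p - X`, so there are at most `p` of them.
-/
theorem SplitsCompletely.absNorm_eq (hp : p.Prime) (h : SplitsCompletely F p)
    (hP : P ∈ primesAbove F p) : absNorm P = p := by
  refine le_antisymm ?_ (le_absNorm_of_mem_primesAbove hp hP)
  have hP' := (mem_primesAbove_iff hp).1 hP
  have : P.IsMaximal := hP'.1.isMaximal (ne_bot_of_mem_primesAbove hp hP)
  let _ := Ideal.Quotient.field P
  have hfin : Finite (𝓞 F ⧸ P) := (absNorm_ne_zero_iff P).1
    (absNorm_eq_zero_iff.not.2 (ne_bot_of_mem_primesAbove hp hP))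
  have := Fintype.ofFinite (𝓞 F ⧸ P)
  have hroot : ∀ y : 𝓞 F ⧸ P, y ^ p - y = 0 := by
    intro y
    obtain ⟨x, rfl⟩ := Ideal.Quotient.mk_surjective y
    rw [← map_pow, ← map_sub, Ideal.Quotient.eq_zero_iff_mem]
    exact P.mem_of_dvd (h x) hP'.2
  have hcard : absNorm P = Fintype.card (𝓞 F ⧸ P) := by
    rw [← Nat.card_eq_fintype_card]; rfl
  rw [hcard, ← FiniteField.X_pow_card_sub_X_natDegree_eq (𝓞 F ⧸ P) hp.one_lt, ← Finset.card_univ]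
  refine Polynomial.card_le_degree_of_subset_roots fun y _ => ?_
  rw [Polynomial.mem_roots (FiniteField.X_pow_card_sub_X_ne_zero _ hp.one_lt)]
  simpa using hroot y

theorem SplitsCompletely.idealCount_eq (hp : p.Prime) (h : SplitsCompletely F p) :
    idealCount F p = Module.finrank ℚ F := by
  -- Iterating gives `x ^ p ^ j ≡ x` mod `p`, so nilpotents mod `p` vanish: `p` is unramified.
  have hrad : (span {(p : 𝓞 F)}).IsRadical := by
    rintro x ⟨k, hk⟩
    have hiter : ∀ j : ℕ, (p : 𝓞 F) ∣ x ^ p ^ j - x := by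
      intro j
      induction j with
      | zero => simp
      | succ j ih =>
        have := dvd_add (h (x ^ p ^ j)) ih
        rwa [← pow_mul, ← pow_succ, sub_add_sub_cancel] at this
    rw [mem_span_singleton] at hk ⊢
    exact (dvd_sub_right (hk.trans (pow_dvd_pow x (Nat.lt_pow_self hp.one_lt).le))).1 (hiter k)
  have hle : ∏ P ∈ primesAbove F p, P ≤ span {(p : 𝓞 F)} := by
    conv_rhs => rw [← hrad.radical, radical_eq_sInf]
    refine le_sInf fun P hP => ?_
    have : P ∈ primesAbove F p :=
      (mem_primesAbove_iff hp).2 ⟨hP.2, (span_singleton_le_iff_mem _).1 hP.1⟩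
    exact Ideal.dvd_iff_le.1 (Finset.dvd_prod_of_mem _ this)
  have heq := absNorm_dvd_absNorm_of_le hle
  rw [absNorm_span_natCast_eq_pow_finrank, map_prod,
    Finset.prod_congr rfl fun P hP => h.absNorm_eq hp hP, Finset.prod_const] at heq
  refine le_antisymm (idealCount_le_finrank hp) ?_
  rw [idealCount_eq_card_filter hp, Finset.filter_true_of_mem fun P hP => h.absNorm_eq hp hP]
  exact (Nat.pow_dvd_pow_iff_le_right hp.one_lt).1 heq

theorem splitsCompletely_iff_idealCount_eq (hp : p.Prime) :
    SplitsCompletely F p ↔ idealCount F p = Module.finrank ℚ F :=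
  ⟨fun h => h.idealCount_eq hp, splitsCompletely_of_idealCount_eq hp⟩

theorem SplitsCompletely.card_primesAbove (hp : p.Prime) (h : SplitsCompletely F p) :
    (primesAbove F p).card = Module.finrank ℚ F := by
  rw [← h.idealCount_eq hp, idealCount_eq_card_filter hp,
    Finset.filter_true_of_mem fun P hP => h.absNorm_eq hp hP]

/-- In a Galois number field, an unramified prime with a prime factor of degree one splits
completely. -/
theorem splitsCompletely_of_absNorm_eq [IsGalois ℚ F] (hp : p.Prime) (hd : ¬ (p : ℤ) ∣ discr F)
    (hP : absNorm P = p) : SplitsCompletely F p := by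
  have hpz : Prime (p : ℤ) := Nat.prime_iff_prime_int.1 hp
  have hunr := (not_dvd_discr_iff_isUnramifiedIn F (𝓞 F) hpz).1 hd
  have : (span {(p : ℤ)}).IsPrime := (span_singleton_prime hpz.ne_zero).2 hpz
  have hover : ∀ Q ∈ primesAbove F p, Q.IsPrime ∧ Q.LiesOver (span {(p : ℤ)}) := by
    intro Q hQ
    have hQ' := (mem_primesAbove_iff hp).1 hQ
    exact ⟨hQ'.1, (liesOver_span_iff hQ'.1.ne_top hpz).2 (by simpa using hQ'.2)⟩
  obtain ⟨hPp, hPo⟩ := hover P (mem_primesAbove_of_absNorm_eq hp hP)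
  -- The Galois group permutes the primes above `p` transitively, so they share one inertia degree.
  have hnorm : ∀ Q ∈ primesAbove F p,
      absNorm Q = p ^ inertiaDegIn (span {(p : ℤ)}) (𝓞 F) := by
    intro Q hQ
    obtain ⟨hQp, hQo⟩ := hover Q hQ
    rw [inertiaDegIn_eq_inertiaDeg (span {(p : ℤ)}) Q Gal(F/ℚ),
      ← absNorm_pow_inertiaDeg (span {(p : ℤ)}) Q]
    simp
  have hf : inertiaDegIn (span {(p : ℤ)}) (𝓞 F) = 1 := by
    have := hnorm P (mem_primesAbove_of_absNorm_eq hp hP)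
    rw [hP] at this
    exact (Nat.pow_right_injective hp.two_le ((pow_one p).trans this)).symm
  have he : ramificationIdxIn (span {(p : ℤ)}) (𝓞 F) = 1 := by
    rw [ramificationIdxIn_eq_ramificationIdx (span {(p : ℤ)}) P Gal(F/ℚ)]
    exact hunr.ramificationIdx_eq_one hPo
  have hcount := ncard_primesOver_mul_ramificationIdxIn_mul_inertiaDegIn (span {(p : ℤ)}) (𝓞 F)
    Gal(F/ℚ)
  rw [he, hf, mul_one, mul_one, IsGalois.card_aut_eq_finrank] at hcount
  refine splitsCompletely_of_idealCount_eq hp ?_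
  rw [idealCount_eq_card_filter hp, Finset.filter_true_of_mem fun Q hQ => by
    rw [hnorm Q hQ, hf, pow_one], ← hcount, ← Set.ncard_coe_finset]
  congr 1
  ext Q
  refine ⟨hover Q, fun hQ => (mem_primesAbove_iff hp).2 ⟨hQ.1, ?_⟩⟩
  simpa using (liesOver_span_iff hQ.1.ne_top hpz).1 hQ.2

end PrimesAbove

/-! ### Transfer of splitting to subfields and from generators -/

section Generation

variable {E F : Type*} [Field E] [Field F] [NumberField E] [NumberField F] {p : ℕ}

/-- The quotient `(x ^ p - x) / p` already lies in `E`, and integrality can be checked after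
embedding in `F`. -/
theorem SplitsCompletely.of_ringHom (hp : p.Prime) (φ : E →+* F) (h : SplitsCompletely F p) :
    SplitsCompletely E p := by
  intro x
  obtain ⟨z, hz⟩ := h (RingOfIntegers.mapRingHom φ x)
  have hp0 : (p : E) ≠ 0 := by exact_mod_cast hp.ne_zero
  have hw : φ (((x : E) ^ p - x) / p) = z := by
    have h1 := congrArg (algebraMap (𝓞 F) F) hz
    simp only [map_sub, map_pow] at h1
    rw [map_div₀, map_sub, map_pow, map_natCast, div_eq_iff (by exact_mod_cast hp.ne_zero),
      mul_comm]
    exact h1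
  have hint : IsIntegral ℤ (((x : E) ^ p - x) / p) := by
    rw [← isIntegral_algHom_iff φ.toIntAlgHom φ.injective]
    exact hw ▸ z.isIntegral_coe
  refine ⟨⟨_, hint⟩, ?_⟩
  apply RingOfIntegers.coe_injective
  simp only [map_sub, map_pow]
  exact (mul_div_cancel₀ _ hp0).symm

/-- Modulo `p` the Frobenius is a ring homomorphism, so its fixed points form a subring. -/
theorem natCast_dvd_pow_sub_of_mem_adjoin {R : Type*} [CommRing R] (hp : p.Prime) {X : Set R}
    (hX : ∀ x ∈ X, (p : R) ∣ x ^ p - x) {y : R} (hy : y ∈ Algebra.adjoin ℤ X) :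
    (p : R) ∣ y ^ p - y := by
  have := Fact.mk hp
  by_cases htop : span {(p : R)} = ⊤
  · exact (isUnit_iff_dvd_one.1 (span_singleton_eq_top.1 htop)).trans (one_dvd _)
  have : Nontrivial (R ⧸ span {(p : R)}) := Ideal.Quotient.nontrivial_iff.2 htop
  have hchar : CharP (R ⧸ span {(p : R)}) p := by
    refine (CharP.charP_iff_prime_eq_zero hp).2 ?_
    rw [← map_natCast (Ideal.Quotient.mk (span {(p : R)})), Ideal.Quotient.eq_zero_iff_mem]
    exact mem_span_singleton_self _
  have key : ∀ z : R, (p : R) ∣ z ^ p - z ↔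
      frobenius (R ⧸ span {(p : R)}) p (Ideal.Quotient.mk _ z) = Ideal.Quotient.mk _ z := by
    intro z
    rw [frobenius_def, ← map_pow, ← sub_eq_zero, ← map_sub, Ideal.Quotient.eq_zero_iff_mem,
      mem_span_singleton]
  simp only [key] at hX ⊢
  induction hy using Algebra.adjoin_induction with
  | mem x hx => exact hX x hx
  | algebraMap r => simp
  | add x y _ _ hx hy => rw [map_add, map_add, hx, hy]
  | mul x y _ _ hx hy => rw [map_mul, map_mul, hx, hy]

theorem exists_natCast_mul_eq_coe_of_mem_adjoin {X : Set (𝓞 F)} {z : F}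
    (hz : z ∈ Algebra.adjoin ℚ (algebraMap (𝓞 F) F '' X)) :
    ∃ N : ℕ, N ≠ 0 ∧ ∃ r ∈ Algebra.adjoin ℤ X, (N : F) * z = algebraMap (𝓞 F) F r := by
  induction hz using Algebra.adjoin_induction with
  | mem x hx =>
    obtain ⟨y, hy, rfl⟩ := hx
    exact ⟨1, one_ne_zero, y, Algebra.subset_adjoin hy, by simp⟩
  | algebraMap r =>
    refine ⟨r.den, r.den_ne_zero, (r.num : 𝓞 F), intCast_mem _ _, ?_⟩
    rw [eq_ratCast, map_intCast]
    exact_mod_cast congrArg (Rat.cast : ℚ → F) (Rat.den_mul_eq_num r)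
  | add x y _ _ hx hy =>
    obtain ⟨N, hN, r, hr, hxr⟩ := hx
    obtain ⟨N', hN', r', hr', hyr⟩ := hy
    refine ⟨N * N', mul_ne_zero hN hN', N' * r + N * r',
      add_mem (mul_mem (natCast_mem _ _) hr) (mul_mem (natCast_mem _ _) hr'), ?_⟩
    simp only [map_add, map_mul, map_natCast, ← hxr, ← hyr, Nat.cast_mul]
    ring
  | mul x y _ _ hx hy =>
    obtain ⟨N, hN, r, hr, hxr⟩ := hx
    obtain ⟨N', hN', r', hr', hyr⟩ := hy
    refine ⟨N * N', mul_ne_zero hN hN', r * r', mul_mem hr hr', ?_⟩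
    simp only [map_mul, ← hxr, ← hyr, Nat.cast_mul]
    ring

theorem exists_forall_natCast_mul_mem_adjoin {X : Set (𝓞 F)}
    (hX : IntermediateField.adjoin ℚ (algebraMap (𝓞 F) F '' X) = ⊤) :
    ∃ N : ℕ, N ≠ 0 ∧ ∀ y : 𝓞 F, (N : 𝓞 F) * y ∈ Algebra.adjoin ℤ X := by
  have hX' : Algebra.adjoin ℚ (algebraMap (𝓞 F) F '' X) = ⊤ := by
    rw [← IntermediateField.adjoin_toSubalgebra_of_isAlgebraic fun x _ =>
      Algebra.IsAlgebraic.isAlgebraic x, hX, IntermediateField.top_toSubalgebra]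
  have hone : ∀ y : 𝓞 F, ∃ N : ℕ, N ≠ 0 ∧ (N : 𝓞 F) * y ∈ Algebra.adjoin ℤ X := by
    intro y
    obtain ⟨N, hN, r, hr, h⟩ := exists_natCast_mul_eq_coe_of_mem_adjoin
      (hX' ▸ Algebra.mem_top : algebraMap (𝓞 F) F y ∈ Algebra.adjoin ℚ (algebraMap (𝓞 F) F '' X))
    refine ⟨N, hN, ?_⟩
    have : (N : 𝓞 F) * y = r := RingOfIntegers.coe_injective (by simpa using h)
    exact this ▸ hr
  choose N hN hmem using fun i => hone (RingOfIntegers.basis F i)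
  refine ⟨∏ i, N i, Finset.prod_ne_zero_iff.2 fun i _ => hN i, fun y => ?_⟩
  rw [← (RingOfIntegers.basis F).sum_repr y, Finset.mul_sum]
  refine sum_mem fun i _ => ?_
  rw [mul_smul_comm]
  refine zsmul_mem ?_ _
  obtain ⟨d, hd⟩ := Finset.dvd_prod_of_mem N (Finset.mem_univ i)
  rw [hd, Nat.cast_mul, mul_comm (N i : 𝓞 F), mul_assoc]
  exact mul_mem (natCast_mem _ _) (hmem i)

/-- Away from finitely many primes, complete splitting can be tested on integral generators of
the field. -/
theorem exists_forall_splitsCompletely_of_adjoin_eq_top {X : Set (𝓞 F)}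
    (hX : IntermediateField.adjoin ℚ (algebraMap (𝓞 F) F '' X) = ⊤) :
    ∃ N : ℕ, N ≠ 0 ∧ ∀ p : ℕ, p.Prime → ¬ p ∣ N → (∀ x ∈ X, (p : 𝓞 F) ∣ x ^ p - x) →
      SplitsCompletely F p := by
  obtain ⟨N, hN, hmem⟩ := exists_forall_natCast_mul_mem_adjoin hX
  refine ⟨N, hN, fun p hp hpN h y => ?_⟩
  have h1 := natCast_dvd_pow_sub_of_mem_adjoin hp h (hmem y)
  -- Fermat's little theorem: `N` lies in the subring generated by the empty set.
  have h2 : (p : 𝓞 F) ∣ (N : 𝓞 F) ^ p - N :=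
    natCast_dvd_pow_sub_of_mem_adjoin hp (X := ∅) (by simp) (natCast_mem _ _)
  have h3 : (p : 𝓞 F) ∣ (N : 𝓞 F) * (y ^ p - y) := by
    have := dvd_sub h1 (h2.mul_right (y ^ p))
    convert this using 1
    ring
  have hcop : IsCoprime (p : 𝓞 F) (N : 𝓞 F) := by
    have := (Nat.isCoprime_iff_coprime.2 ((Nat.Prime.coprime_iff_not_dvd hp).2 hpN)).map
      (Int.castRingHom (𝓞 F))
    simpa using this
  exact hcop.dvd_of_dvd_mul_left h3

end Generation

/-! ### The zeta function as a sum over ideals -/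

section IdealZeta

open Filter Topology
open scoped nonZeroDivisors

variable (F : Type*) [Field F] [NumberField F]

/-- The Dedekind zeta function at a real argument. -/
noncomputable def idealZeta (s : ℝ) : ℝ := ∑' n : ℕ, (idealCount F n : ℝ) * (n : ℝ) ^ (-s)

variable {F}

theorem sum_Icc_idealCount (n : ℕ) :
    ∑ k ∈ Finset.Icc 1 n, idealCount F k =
      Nat.card {I : (Ideal (𝓞 F))⁰ // absNorm (I : Ideal (𝓞 F)) ≤ n} := by
  simp only [idealCount]
  rw [← add_left_inj 1, ← card_norm_le_eq_card_norm_le_add_one,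
    show Finset.Icc 1 n = Finset.Ioc 0 n from Finset.Icc_succ_left_eq_Ioc _ _,
    show 1 = Nat.card {I : Ideal (𝓞 F) // absNorm I = 0} by simp [Ideal.absNorm_eq_zero_iff],
    Finset.sum_Ioc_add_eq_sum_Icc (n.zero_le),
    ← Finset.card_preimage_eq_sum_card_image_eq (fun k _ ↦ finite_setOfPred_absNorm_eq k)]
  simp [Set.coe_eq_subtype]

theorem lseriesSummable_idealCount {s : ℂ} (hs : 1 < s.re) :
    LSeriesSummable (fun n => (idealCount F n : ℂ)) s := by
  have h := LSeriesSummable_of_sum_norm_bigO_and_nonneg (f := fun n => (idealCount F n : ℝ))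
    (r := 1) (s := s) ?_ (fun _ => Nat.cast_nonneg _) zero_le_one hs
  · simpa using h
  have h0 := (NumberField.Ideal.tendsto_norm_le_div_atTop₀ F).comp tendsto_natCast_atTop_atTop
  refine Asymptotics.isBigO_of_div_tendsto_nhds (Eventually.of_forall fun n hn => ?_) _
    (h0.congr fun n => ?_)
  · have : n = 0 := by simpa using hn
    subst this
    simp
  · simp only [Function.comp_apply, Pi.div_apply, Nat.cast_le, Real.rpow_one, ← Nat.cast_sum,
      sum_Icc_idealCount]

theorem abscissaOfAbsConv_idealCount_lt_top :
    LSeries.abscissaOfAbsConv (fun n => (idealCount F n : ℂ)) < ⊤ :=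
  (LSeriesSummable.abscissaOfAbsConv_le
    (lseriesSummable_idealCount (F := F) (s := 2) (by norm_num))).trans_lt (EReal.coe_lt_top _)

theorem lseries_term_idealCount {s : ℝ} (hs : s ≠ 0) (n : ℕ) :
    LSeries.term (fun n => (idealCount F n : ℂ)) s n =
      (((idealCount F n : ℝ) * (n : ℝ) ^ (-s) : ℝ) : ℂ) := by
  rcases eq_or_ne n 0 with rfl | hn
  · simp [Real.zero_rpow (neg_ne_zero.2 hs)]
  · rw [LSeries.term_of_ne_zero hn, Complex.ofReal_mul, Complex.ofReal_cpow n.cast_nonneg,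
      Complex.ofReal_neg, Complex.cpow_neg, div_eq_mul_inv]
    simp

theorem summable_idealCount {s : ℝ} (hs : 1 < s) :
    Summable fun n : ℕ => (idealCount F n : ℝ) * (n : ℝ) ^ (-s) := by
  have h : LSeriesSummable (fun n => (idealCount F n : ℂ)) s :=
    lseriesSummable_idealCount (by simpa using hs)
  rw [LSeriesSummable, funext (lseries_term_idealCount (F := F) (by linarith : s ≠ 0))] at h
  exact_mod_cast h

theorem dedekindZeta_ofReal {s : ℝ} (hs : 1 < s) : dedekindZeta F s = (idealZeta F s : ℂ) := by
  rw [idealZeta, Complex.ofReal_tsum]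
  exact tsum_congr (lseries_term_idealCount (by linarith))

theorem tendsto_sub_one_mul_idealZeta :
    Tendsto (fun s : ℝ => (s - 1) * idealZeta F s) (𝓝[>] 1) (𝓝 (dedekindZeta_residue F)) := by
  have h := tendsto_sub_one_mul_dedekindZeta_nhdsGT F
  rw [← tendsto_ofReal_iff]
  refine h.congr' ?_
  filter_upwards [self_mem_nhdsWithin] with s hs
  rw [dedekindZeta_ofReal hs]
  push_cast
  rfl

theorem idealCount_eq_of_dedekindZeta_eq {E : Type*} [Field E] [NumberField E]
    (h : ∀ s : ℂ, 1 < s.re → dedekindZeta E s = dedekindZeta F s) {n : ℕ} (hn : n ≠ 0) :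
    idealCount E n = idealCount F n := by
  have := LSeries.eq_of_LSeries_eventually_eq (f := fun n => (idealCount E n : ℂ))
    (g := fun n => (idealCount F n : ℂ)) abscissaOfAbsConv_idealCount_lt_top
    abscissaOfAbsConv_idealCount_lt_top ?_ hn
  · exact_mod_cast this
  · filter_upwards [eventually_gt_atTop 1] with x hx
    exact h x (by simpa using hx)

theorem sum_absNorm_rpow_le_idealZeta {s : ℝ} (hs : 1 < s) (T : Finset (Ideal (𝓞 F))) :
    ∑ I ∈ T, (absNorm I : ℝ) ^ (-s) ≤ idealZeta F s := by
  classical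
  rw [← Finset.sum_fiberwise_of_maps_to (t := T.image absNorm)
    fun I hI => Finset.mem_image_of_mem _ hI]
  refine le_trans (Finset.sum_le_sum fun n _ => ?_)
    ((summable_idealCount hs).sum_le_tsum (T.image absNorm) fun n _ => by positivity)
  rw [Finset.sum_congr rfl (g := fun _ => (n : ℝ) ^ (-s)) fun I hI => by
    rw [(Finset.mem_filter.1 hI).2], Finset.sum_const, nsmul_eq_mul]
  refine mul_le_mul_of_nonneg_right ?_ (by positivity)
  have hfin : {I : Ideal (𝓞 F) | absNorm I = n}.Finite := finite_setOfPred_absNorm_eq n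
  rw [Nat.cast_le, idealCount, ← Set.ncard_coe_finset]
  exact Set.ncard_le_ncard (fun I hI => (Finset.mem_filter.1 hI).2) hfin

theorem idealZeta_le_of_forall_sum_le {s B : ℝ} (hs : 1 < s)
    (h : ∀ T : Finset (Ideal (𝓞 F)), (∀ I ∈ T, I ≠ ⊥) → ∑ I ∈ T, (absNorm I : ℝ) ^ (-s) ≤ B) :
    idealZeta F s ≤ B := by
  classical
  refine (summable_idealCount hs).tsum_le_of_sum_le fun T => ?_
  have hfin : {I : Ideal (𝓞 F) | absNorm I ∈ T.erase 0}.Finite :=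
    Set.Finite.preimage' (T.erase 0).finite_toSet fun n _ => finite_setOfPred_absNorm_eq n
  refine le_trans (le_of_eq ?_) (h hfin.toFinset fun I hI hbot => ?_)
  -- The zero ideal makes `idealCount F 0 = 1`, but its term vanishes because `0 ^ (-s) = 0`.
  · rw [← Finset.sum_erase T (a := 0) (by simp [Real.zero_rpow (by linarith : -s ≠ 0)]),
      ← Finset.sum_fiberwise_of_maps_to (s := hfin.toFinset) (t := T.erase 0) (g := absNorm)
        fun I hI => hfin.mem_toFinset.1 hI]
    refine Finset.sum_congr rfl fun n hn => ?_
    rw [Finset.sum_congr rfl (g := fun _ => (n : ℝ) ^ (-s)) fun I hI => by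
      rw [(Finset.mem_filter.1 hI).2], Finset.sum_const, nsmul_eq_mul, idealCount,
      ← Set.ncard_coe_finset]
    congr 2
    refine congrArg Set.ncard (Set.ext fun I => ?_)
    simp only [Finset.coe_filter, Set.Finite.mem_toFinset, Set.mem_ofPred_eq]
    exact ⟨fun hI => ⟨hI.symm ▸ hn, hI⟩, fun hI => hI.2⟩
  · simp [hbot] at hI

end IdealZeta

/-! ### Euler product inequalities with finite products -/

section EulerProduct

variable {F : Type*} [Field F] [NumberField F]

/-- Follows from `exp (-u) ≥ 1 - u` at `u = x - x ^ 2` and `(1 + x) * (1 - x + x ^ 2) = 1 + x ^ 3 ≥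
1`. -/
theorem Real.exp_sub_sq_le_one_add {x : ℝ} (hx : 0 ≤ x) : Real.exp (x - x ^ 2) ≤ 1 + x := by
  have h := Real.add_one_le_exp (-(x - x ^ 2))
  rw [Real.exp_neg] at h
  have he := Real.exp_pos (x - x ^ 2)
  have h1 : Real.exp (x - x ^ 2) * (-(x - x ^ 2) + 1) ≤ 1 := by
    calc _ ≤ Real.exp (x - x ^ 2) * (Real.exp (x - x ^ 2))⁻¹ := by gcongr
      _ = 1 := mul_inv_cancel₀ he.ne'
  have h2 : 0 < -(x - x ^ 2) + 1 := by nlinarith [sq_nonneg (x - 1)]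
  refine le_of_mul_le_mul_right (h1.trans ?_) h2
  nlinarith [pow_nonneg hx 3]

theorem Real.inv_one_sub_le_exp {x : ℝ} (hx : x ≤ 1 / 2) :
    (1 - x)⁻¹ ≤ Real.exp (x + 2 * x ^ 2) := by
  have h0 : 0 < 1 - x := by linarith
  have h1 : (1 - x)⁻¹ = x / (1 - x) + 1 := by field_simp; ring
  rw [h1]
  refine (Real.add_one_le_exp _).trans (Real.exp_le_exp.2 ?_)
  rw [div_le_iff₀ h0]
  nlinarith [mul_nonneg (sq_nonneg x) (by linarith : (0 : ℝ) ≤ 1 - 2 * x)]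

theorem rpow_absNorm_prod {ι : Type*} (T : Finset ι) (f : ι → Ideal (𝓞 F)) (s : ℝ) :
    (absNorm (∏ i ∈ T, f i) : ℝ) ^ (-s) = ∏ i ∈ T, (absNorm (f i) : ℝ) ^ (-s) := by
  rw [map_prod, Nat.cast_prod, Real.finsetProd_rpow _ _ fun _ _ => Nat.cast_nonneg _]

theorem injOn_prod_powerset_of_prime {A : Finset (Ideal (𝓞 F))} (hA : ∀ P ∈ A, Prime P) :
    Set.InjOn (fun B : Finset (Ideal (𝓞 F)) => ∏ P ∈ B, P) (A.powerset : Set _) := by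
  have key : ∀ B ∈ A.powerset, ∀ P ∈ A, P ∣ ∏ Q ∈ B, Q ↔ P ∈ B := by
    intro B hB P hP
    refine ⟨fun h => ?_, fun h => Finset.dvd_prod_of_mem _ h⟩
    obtain ⟨Q, hQ, hPQ⟩ := ((hA P hP).dvd_finsetProd_iff _).1 h
    have := (hA P hP).associated_of_dvd (hA Q (Finset.mem_powerset.1 hB hQ)) hPQ
    exact (associated_iff_eq.1 this) ▸ hQ
  intro B hB C hC h
  ext P
  constructor
  · intro hP
    have hPA := Finset.mem_powerset.1 hB hP
    exact (key C hC P hPA).1 (by simpa only [← h] using (key B hB P hPA).2 hP)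
  · intro hP
    have hPA := Finset.mem_powerset.1 hC hP
    exact (key B hB P hPA).1 (by simpa only [h] using (key C hC P hPA).2 hP)

/-- Expanding gives one term per subset of `A`; by unique factorization distinct subsets have
distinct products. -/
theorem exists_prod_one_add_eq_sum {A : Finset (Ideal (𝓞 F))} (hA : ∀ P ∈ A, Prime P) (s : ℝ) :
    ∃ T : Finset (Ideal (𝓞 F)),
      ∏ P ∈ A, (1 + (absNorm P : ℝ) ^ (-s)) = ∑ I ∈ T, (absNorm I : ℝ) ^ (-s) := by
  classical
  refine ⟨A.powerset.image fun B => ∏ P ∈ B, P, ?_⟩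
  rw [Finset.sum_image (injOn_prod_powerset_of_prime hA), Finset.prod_one_add]
  exact Finset.sum_congr rfl fun B _ => (rpow_absNorm_prod B id s).symm

theorem two_le_absNorm_of_prime {P : Ideal (𝓞 F)} (hP : Prime P) : 2 ≤ absNorm P := by
  have h0 : absNorm P ≠ 0 := absNorm_eq_zero_iff.not.2 hP.ne_zero
  have h1 : absNorm P ≠ 1 := absNorm_eq_one_iff.not.2 (isPrime_of_prime hP).ne_top
  omega

theorem rpow_absNorm_le_half {P : Ideal (𝓞 F)} (hP : Prime P) {s : ℝ} (hs : 1 < s) :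
    (absNorm P : ℝ) ^ (-s) ≤ 1 / 2 := by
  have h2 : (2 : ℝ) ≤ absNorm P := by exact_mod_cast two_le_absNorm_of_prime hP
  calc (absNorm P : ℝ) ^ (-s) ≤ (absNorm P : ℝ) ^ (-1 : ℝ) :=
        Real.rpow_le_rpow_of_exponent_le (by linarith) (by linarith)
    _ = (absNorm P : ℝ)⁻¹ := Real.rpow_neg_one _
    _ ≤ 1 / 2 := by rw [one_div]; exact inv_anti₀ two_pos h2

/-- Take all primes dividing members of `T`. Exponent vectors determine the ideals and are bounded
by `N`, so the sum is part of an expanded product of truncated geometric series. -/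
theorem exists_sum_le_prod_inv_one_sub {T : Finset (Ideal (𝓞 F))} (hT : ∀ I ∈ T, I ≠ ⊥) {s : ℝ}
    (hs : 1 < s) : ∃ A : Finset (Ideal (𝓞 F)), (∀ P ∈ A, Prime P) ∧
      ∑ I ∈ T, (absNorm I : ℝ) ^ (-s) ≤ ∏ P ∈ A, (1 - (absNorm P : ℝ) ^ (-s))⁻¹ := by
  classical
  set A : Finset (Ideal (𝓞 F)) := T.biUnion fun I => (normalizedFactors I).toFinset
  set N : ℕ := T.sup fun I => (normalizedFactors I).card
  have hA : ∀ P ∈ A, Prime P := by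
    intro P hP
    obtain ⟨I, -, hI⟩ := Finset.mem_biUnion.1 hP
    exact prime_of_normalized_factor P (Multiset.mem_toFinset.1 hI)
  have hfac : ∀ I ∈ T, ∏ P : A, (P : Ideal (𝓞 F)) ^ (normalizedFactors I).count (P : Ideal (𝓞 F))
      = I := by
    intro I hI
    rw [Finset.prod_coe_sort A fun P => P ^ (normalizedFactors I).count P,
      ← Finset.prod_multiset_count_of_subset _ _
        (Finset.subset_biUnion_of_mem (fun I => (normalizedFactors I).toFinset) hI)]
    exact associated_iff_eq.1 (prod_normalizedFactors (hT I hI))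
  refine ⟨A, hA, ?_⟩
  calc ∑ I ∈ T, (absNorm I : ℝ) ^ (-s)
      = ∑ I ∈ T, ∏ P : A, ((absNorm (P : Ideal (𝓞 F)) : ℝ) ^ (-s)) ^
          (normalizedFactors I).count (P : Ideal (𝓞 F)) := by
        refine Finset.sum_congr rfl fun I hI => ?_
        conv_lhs => rw [← hfac I hI]
        rw [rpow_absNorm_prod]
        refine Finset.prod_congr rfl fun P _ => ?_
        rw [map_pow, Nat.cast_pow, ← Real.rpow_natCast, ← Real.rpow_natCast,
          ← Real.rpow_mul (Nat.cast_nonneg _), ← Real.rpow_mul (Nat.cast_nonneg _), mul_comm]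
    _ = ∑ e ∈ T.image fun I (P : A) => (normalizedFactors I).count (P : Ideal (𝓞 F)),
          ∏ P : A, ((absNorm (P : Ideal (𝓞 F)) : ℝ) ^ (-s)) ^ e P := by
        rw [Finset.sum_image]
        intro I hI J hJ h
        rw [← hfac I hI, ← hfac J hJ]
        exact Finset.prod_congr rfl fun P _ => congrArg _ (congrFun h P)
    _ ≤ ∑ e ∈ Fintype.piFinset fun _ : A => Finset.range (N + 1),
          ∏ P : A, ((absNorm (P : Ideal (𝓞 F)) : ℝ) ^ (-s)) ^ e P := by
        refine Finset.sum_le_sum_of_subset_of_nonneg ?_ fun e _ _ =>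
          Finset.prod_nonneg fun P _ => by positivity
        intro e he
        obtain ⟨I, hI, rfl⟩ := Finset.mem_image.1 he
        rw [Fintype.mem_piFinset]
        intro P
        rw [Finset.mem_range, Nat.lt_succ_iff]
        exact (Multiset.count_le_card _ _).trans
          (Finset.le_sup (f := fun I => (normalizedFactors I).card) hI)
    _ = ∏ P : A, ∑ k ∈ Finset.range (N + 1), ((absNorm (P : Ideal (𝓞 F)) : ℝ) ^ (-s)) ^ k :=
        (Finset.prod_univ_sum _ _).symm
    _ ≤ ∏ P : A, (1 - (absNorm (P : Ideal (𝓞 F)) : ℝ) ^ (-s))⁻¹ := by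
        refine Finset.prod_le_prod (fun P _ => Finset.sum_nonneg fun k _ => by positivity)
          fun P _ => ?_
        have h0 : 0 ≤ (absNorm (P : Ideal (𝓞 F)) : ℝ) ^ (-s) := by positivity
        have h1 := rpow_absNorm_le_half (hA P P.2) hs
        rw [← tsum_geometric_of_lt_one h0 (by linarith)]
        exact (summable_geometric_of_lt_one h0 (by linarith)).sum_le_tsum _
          fun k _ => by positivity
    _ = ∏ P ∈ A, (1 - (absNorm P : ℝ) ^ (-s))⁻¹ :=
        Finset.prod_coe_sort A fun P => (1 - (absNorm P : ℝ) ^ (-s))⁻¹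

/-- The norm is a power of the rational prime below `P`, so `minFac` recovers that prime. -/
theorem mem_primesAbove_minFac {P : Ideal (𝓞 F)} (hP : Prime P) :
    (absNorm P).minFac.Prime ∧ P ∈ primesAbove F (absNorm P).minFac := by
  have h2 := two_le_absNorm_of_prime hP
  have hp : (absNorm P).minFac.Prime := Nat.minFac_prime (by omega)
  have hPp := isPrime_of_prime hP
  have hmax : P.IsMaximal := hPp.isMaximal hP.ne_zero
  obtain ⟨p, hp', k, hk⟩ : ∃ p : ℕ, p.Prime ∧ ∃ k, k ≠ 0 ∧ absNorm P = p ^ k := by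
    obtain ⟨Q, hQ, hQu, hQd⟩ := exists_isMaximal_dvd_of_dvd_absNorm' hp P (Nat.minFac_dvd _)
    have hPQ : Q = P := (hmax.eq_of_le hQ.ne_top (Ideal.dvd_iff_le.1 hQd)).symm
    refine ⟨_, hp, exists_absNorm_eq_pow_of_mem_primesAbove hp
      ((mem_primesAbove_iff hp).2 ⟨hPp, ?_⟩)⟩
    have : ((absNorm P).minFac : ℤ) ∈ Q.under ℤ := hQu ▸ mem_span_singleton_self _
    rw [Ideal.mem_comap, hPQ] at this
    simpa using this
  refine ⟨hp, (mem_primesAbove_iff hp).2 ⟨hPp, ?_⟩⟩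
  have hmem := absNorm_mem P
  rw [hk.2, hp'.pow_minFac hk.1]
  rw [hk.2, Nat.cast_pow] at hmem
  exact hPp.mem_of_pow_mem _ hmem

theorem sum_minFac_absNorm_le {A : Finset (Ideal (𝓞 F))} (hA : ∀ P ∈ A, Prime P) {g : ℕ → ℝ}
    (hg : Summable g) (hg0 : ∀ n, 0 ≤ g n) :
    ∑ P ∈ A, g (absNorm P).minFac ≤ Module.finrank ℚ F * ∑' n, g n := by
  classical
  rw [← Finset.sum_fiberwise_of_maps_to (t := A.image fun P => (absNorm P).minFac)
    fun P hP => Finset.mem_image_of_mem _ hP]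
  calc _ ≤ ∑ n ∈ A.image fun P => (absNorm P).minFac, Module.finrank ℚ F * g n := by
        refine Finset.sum_le_sum fun n hn => ?_
        rw [Finset.sum_congr rfl (g := fun _ => g n) fun I hI => by
          rw [(Finset.mem_filter.1 hI).2], Finset.sum_const, nsmul_eq_mul]
        refine mul_le_mul_of_nonneg_right ?_ (hg0 n)
        obtain ⟨Q, hQ, rfl⟩ := Finset.mem_image.1 hn
        refine Nat.cast_le.2 (le_trans (Finset.card_le_card fun P hP => ?_)
          (card_primesAbove_le (mem_primesAbove_minFac (hA Q hQ)).1))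
        rw [Finset.mem_filter] at hP
        exact hP.2 ▸ (mem_primesAbove_minFac (hA P hP.1)).2
    _ = Module.finrank ℚ F * ∑ n ∈ A.image fun P => (absNorm P).minFac, g n :=
        (Finset.mul_sum _ _ _).symm
    _ ≤ _ := by
        gcongr
        exact hg.sum_le_tsum _ fun n _ => hg0 n

end EulerProduct

/-! ### Density of completely split primes -/

section SplitSum

open Filter Topology

variable (F : Type*) [Field F]

/-- The sum of `p ^ (-s)` over the rational primes `p` that split completely in `F`. -/
noncomputable def splitSum (s : ℝ) : ℝ :=
  ∑' n : ℕ, {p : ℕ | p.Prime ∧ SplitsCompletely F p}.indicator (fun p => (p : ℝ) ^ (-s)) n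

variable {F}

theorem splitSum_term_nonneg (s : ℝ) (n : ℕ) :
    0 ≤ {p : ℕ | p.Prime ∧ SplitsCompletely F p}.indicator (fun p => (p : ℝ) ^ (-s)) n :=
  Set.indicator_nonneg (fun _ _ => by positivity) n

theorem summable_splitSum {s : ℝ} (hs : 1 < s) : Summable fun n : ℕ =>
    {p : ℕ | p.Prime ∧ SplitsCompletely F p}.indicator (fun p => (p : ℝ) ^ (-s)) n :=
  (Real.summable_nat_rpow.2 (by linarith)).indicator _

/-- Each exceptional prime divides `N` and contributes at most 1. -/
theorem splitSum_le_add_card {M : Type*} [Field M] {N : ℕ} (hN : N ≠ 0)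
    (h : ∀ p : ℕ, p.Prime → ¬ p ∣ N → SplitsCompletely F p → SplitsCompletely M p) {s : ℝ}
    (hs : 1 < s) : splitSum F s ≤ splitSum M s + N.divisors.card := by
  classical
  have hfin : HasSum (fun n : ℕ => if n ∈ N.divisors then (1 : ℝ) else 0) N.divisors.card := by
    have := hasSum_sum_of_ne_finset_zero (f := fun n : ℕ => if n ∈ N.divisors then (1 : ℝ) else 0)
      (s := N.divisors) (L := .unconditional _) fun n hn => if_neg hn
    rwa [Finset.sum_ite_mem, Finset.inter_self, Finset.sum_const, nsmul_eq_mul, mul_one] at this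
  rw [splitSum, splitSum, ← hfin.tsum_eq, ← (summable_splitSum hs).tsum_add hfin.summable]
  refine (summable_splitSum hs).tsum_le_tsum (fun n => ?_)
    ((summable_splitSum hs).add hfin.summable)
  by_cases hn : n ∈ {p : ℕ | p.Prime ∧ SplitsCompletely F p}
  · rw [Set.indicator_of_mem hn]
    by_cases hd : n ∣ N
    · rw [if_pos (Nat.mem_divisors.2 ⟨hd, hN⟩)]
      refine le_add_of_nonneg_of_le (splitSum_term_nonneg s n) ?_
      exact Real.rpow_le_one_of_one_le_of_nonpos (by exact_mod_cast hn.1.one_le) (by linarith)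
    · rw [Set.indicator_of_mem (show n ∈ {p : ℕ | p.Prime ∧ SplitsCompletely M p} from
        ⟨hn.1, h n hn.1 hd hn.2⟩)]
      exact le_add_of_nonneg_right (by split_ifs <;> simp)
  · rw [Set.indicator_of_notMem hn]
    exact add_nonneg (splitSum_term_nonneg s n) (by split_ifs <;> simp)

variable [NumberField F]

theorem summable_nat_rpow_neg_two : Summable fun n : ℕ => (n : ℝ) ^ (-2 : ℝ) :=
  Real.summable_nat_rpow.2 (by norm_num)

theorem rpow_absNorm_le_rpow_neg_one {P : Ideal (𝓞 F)} {p : ℕ} (hp : p.Prime)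
    (hP : P ∈ primesAbove F p) {s : ℝ} (hs : 1 < s) :
    (absNorm P : ℝ) ^ (-s) ≤ (p : ℝ) ^ (-1 : ℝ) := by
  have h1 : (1 : ℝ) ≤ p := by exact_mod_cast hp.one_le
  have h2 : (p : ℝ) ≤ absNorm P := by exact_mod_cast le_absNorm_of_mem_primesAbove hp hP
  exact (Real.rpow_le_rpow_of_nonpos (by linarith) h2 (by linarith)).trans
    (Real.rpow_le_rpow_of_exponent_le h1 (by linarith))

theorem sq_rpow_absNorm_le {P : Ideal (𝓞 F)} {p : ℕ} (hp : p.Prime)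
    (hP : P ∈ primesAbove F p) {s : ℝ} (hs : 1 < s) :
    ((absNorm P : ℝ) ^ (-s)) ^ 2 ≤ (p : ℝ) ^ (-2 : ℝ) := by
  calc ((absNorm P : ℝ) ^ (-s)) ^ 2 ≤ ((p : ℝ) ^ (-1 : ℝ)) ^ 2 :=
        pow_le_pow_left₀ (by positivity) (rpow_absNorm_le_rpow_neg_one hp hP hs) 2
    _ = (p : ℝ) ^ (-2 : ℝ) := by
        rw [← Real.rpow_natCast, ← Real.rpow_mul (Nat.cast_nonneg _)]
        norm_num

/-- A prime of norm `p` lies over a split `p`, or else `p` divides the discriminant `d` and `p⁻¹ ≤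
|d| p⁻²`. Any other prime has norm at least `p ^ 2`. The error is thus summable, uniformly in `s`.
-/
theorem rpow_absNorm_le_indicator_add [IsGalois ℚ F] {P : Ideal (𝓞 F)} {p : ℕ} (hp : p.Prime)
    (hP : P ∈ primesAbove F p) {s : ℝ} (hs : 1 < s) :
    (absNorm P : ℝ) ^ (-s) ≤
      {p : ℕ | p.Prime ∧ SplitsCompletely F p}.indicator (fun p => (p : ℝ) ^ (-s)) p +
        (discr F).natAbs * (p : ℝ) ^ (-2 : ℝ) := by
  have hp1 : (1 : ℝ) ≤ p := by exact_mod_cast hp.one_le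
  have hd0 : 0 < (discr F).natAbs := Int.natAbs_pos.2 (discr_ne_zero F)
  have hd1 : (1 : ℝ) ≤ (discr F).natAbs := by exact_mod_cast hd0
  have hind := splitSum_term_nonneg (F := F) s p
  rcases absNorm_eq_or_sq_le_of_mem_primesAbove hp hP with h | h
  · by_cases hsplit : SplitsCompletely F p
    · rw [Set.indicator_of_mem (show p ∈ {p : ℕ | p.Prime ∧ SplitsCompletely F p} from
        ⟨hp, hsplit⟩), h]
      exact le_add_of_nonneg_right (by positivity)
    · have hdvd : (p : ℤ) ∣ discr F := by
        by_contra hd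
        exact hsplit (splitsCompletely_of_absNorm_eq hp hd h)
      have hle : (p : ℝ) ≤ (discr F).natAbs := by
        exact_mod_cast Nat.le_of_dvd hd0 (Int.natCast_dvd.1 hdvd)
      refine (rpow_absNorm_le_rpow_neg_one hp hP hs).trans (le_add_of_nonneg_of_le hind ?_)
      calc (p : ℝ) ^ (-1 : ℝ) = p * (p : ℝ) ^ (-2 : ℝ) := by
            conv_rhs => rw [← Real.rpow_one_add' (by linarith) (by norm_num)]
            norm_num
        _ ≤ _ := by gcongr
  · refine le_add_of_nonneg_of_le hind ?_
    have h' : (p : ℝ) ^ 2 ≤ absNorm P := by exact_mod_cast h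
    calc (absNorm P : ℝ) ^ (-s) ≤ ((p : ℝ) ^ 2) ^ (-s) :=
          Real.rpow_le_rpow_of_nonpos (by positivity) h' (by linarith)
      _ ≤ ((p : ℝ) ^ 2) ^ (-1 : ℝ) :=
          Real.rpow_le_rpow_of_exponent_le (one_le_pow₀ hp1) (by linarith)
      _ = (p : ℝ) ^ (-2 : ℝ) := by
          rw [← Real.rpow_natCast, ← Real.rpow_mul (Nat.cast_nonneg _)]
          norm_num
      _ ≤ _ := le_mul_of_one_le_left (by positivity) hd1

theorem sum_sub_sq_le_log_idealZeta {A : Finset (Ideal (𝓞 F))} (hA : ∀ P ∈ A, Prime P) {s : ℝ}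
    (hs : 1 < s) : ∑ P ∈ A, ((absNorm P : ℝ) ^ (-s) - ((absNorm P : ℝ) ^ (-s)) ^ 2) ≤
      Real.log (idealZeta F s) := by
  obtain ⟨T, hT⟩ := exists_prod_one_add_eq_sum hA s
  have h1 : Real.exp (∑ P ∈ A, ((absNorm P : ℝ) ^ (-s) - ((absNorm P : ℝ) ^ (-s)) ^ 2)) ≤
      idealZeta F s := by
    rw [Real.exp_sum]
    exact (Finset.prod_le_prod (fun _ _ => (Real.exp_pos _).le) fun P _ =>
      Real.exp_sub_sq_le_one_add (by positivity)).trans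
        (hT.trans_le (sum_absNorm_rpow_le_idealZeta hs T))
  exact (Real.le_log_iff_exp_le ((Real.exp_pos _).trans_le h1)).2 h1

theorem idealZeta_pos {s : ℝ} (hs : 1 < s) : 0 < idealZeta F s := by
  have := sum_absNorm_rpow_le_idealZeta (F := F) hs {⊤}
  simp only [Finset.sum_singleton, absNorm_top, Nat.cast_one, Real.one_rpow] at this
  linarith

/-- Keep only the primes above split `p`: each such `p` has `[F:ℚ]` of them, all of norm `p`. No
Galois assumption is needed in this direction. -/
theorem finrank_mul_splitSum_le {s : ℝ} (hs : 1 < s) :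
    Module.finrank ℚ F * splitSum F s ≤ Real.log (idealZeta F s) +
      Module.finrank ℚ F * ∑' n : ℕ, (n : ℝ) ^ (-2 : ℝ) := by
  classical
  rw [splitSum, ← tsum_mul_left]
  refine ((summable_splitSum hs).mul_left _).tsum_le_of_sum_le fun T => ?_
  set S := {p : ℕ | p.Prime ∧ SplitsCompletely F p}
  set A := (T.filter (· ∈ S)).biUnion (primesAbove F)
  have hmem : ∀ P ∈ A, ∃ p ∈ S, P ∈ primesAbove F p := fun P hP => by
    obtain ⟨p, hp, hPp⟩ := Finset.mem_biUnion.1 hP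
    exact ⟨p, (Finset.mem_filter.1 hp).2, hPp⟩
  have hA : ∀ P ∈ A, Prime P := fun P hP => by
    obtain ⟨p, hp, hPp⟩ := hmem P hP
    exact prime_of_mem_primesAbove hp.1 hPp
  have hsq : ∑ P ∈ A, ((absNorm P : ℝ) ^ (-s)) ^ 2 ≤
      Module.finrank ℚ F * ∑' n : ℕ, (n : ℝ) ^ (-2 : ℝ) :=
    (Finset.sum_le_sum fun P hP => sq_rpow_absNorm_le (mem_primesAbove_minFac (hA P hP)).1
      (mem_primesAbove_minFac (hA P hP)).2 hs).trans
      (sum_minFac_absNorm_le hA summable_nat_rpow_neg_two fun n => by positivity)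
  have hlin : ∑ P ∈ A, (absNorm P : ℝ) ^ (-s) =
      ∑ n ∈ T, Module.finrank ℚ F * S.indicator (fun p : ℕ => (p : ℝ) ^ (-s)) n := by
    rw [Finset.sum_biUnion]
    · rw [Finset.sum_filter]
      refine Finset.sum_congr rfl fun p _ => ?_
      split_ifs with hp
      · rw [Set.indicator_of_mem hp, Finset.sum_congr rfl (g := fun _ => (p : ℝ) ^ (-s))
          fun P hP => by rw [hp.2.absNorm_eq hp.1 hP], Finset.sum_const,
          hp.2.card_primesAbove hp.1, nsmul_eq_mul]
      · rw [Set.indicator_of_notMem hp, mul_zero]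
    · intro p hp q hq hpq
      have hp' := (Finset.mem_filter.1 hp).2
      have hq' := (Finset.mem_filter.1 hq).2
      refine Finset.disjoint_left.2 fun P hP hQ => hpq ?_
      rw [← hp'.2.absNorm_eq hp'.1 hP, ← hq'.2.absNorm_eq hq'.1 hQ]
  have := sum_sub_sq_le_log_idealZeta hA hs
  rw [Finset.sum_sub_distrib, hlin] at this
  linarith

theorem log_idealZeta_le [IsGalois ℚ F] : ∃ C : ℝ, ∀ s : ℝ, 1 < s →
    Real.log (idealZeta F s) ≤ Module.finrank ℚ F * splitSum F s + C := by
  -- `|d|` comes from the non-split primes, `2` from the quadratic term in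
  -- `Real.inv_one_sub_le_exp`.
  refine ⟨Module.finrank ℚ F * (((discr F).natAbs + 2) * ∑' n : ℕ, (n : ℝ) ^ (-2 : ℝ)),
    fun s hs => ?_⟩
  rw [Real.log_le_iff_le_exp (idealZeta_pos hs)]
  refine idealZeta_le_of_forall_sum_le hs fun T hT => ?_
  obtain ⟨A, hA, hle⟩ := exists_sum_le_prod_inv_one_sub hT hs
  refine hle.trans ?_
  calc ∏ P ∈ A, (1 - (absNorm P : ℝ) ^ (-s))⁻¹
      ≤ ∏ P ∈ A, Real.exp ((absNorm P : ℝ) ^ (-s) + 2 * ((absNorm P : ℝ) ^ (-s)) ^ 2) := by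
        refine Finset.prod_le_prod (fun P hP => ?_) fun P hP =>
          Real.inv_one_sub_le_exp (rpow_absNorm_le_half (hA P hP) hs)
        have := rpow_absNorm_le_half (hA P hP) hs
        exact inv_nonneg.2 (by linarith)
    _ = Real.exp (∑ P ∈ A, ((absNorm P : ℝ) ^ (-s) + 2 * ((absNorm P : ℝ) ^ (-s)) ^ 2)) :=
        (Real.exp_sum _ _).symm
    _ ≤ _ := Real.exp_le_exp.2 ?_
  have hsum := (summable_splitSum (F := F) hs).add
    (summable_nat_rpow_neg_two.mul_left (((discr F).natAbs : ℝ) + 2))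
  refine le_trans (Finset.sum_le_sum fun P hP => ?_)
    ((sum_minFac_absNorm_le hA hsum fun n =>
      add_nonneg (splitSum_term_nonneg s n) (by positivity)).trans_eq ?_)
  · obtain ⟨hp, hPp⟩ := mem_primesAbove_minFac (hA P hP)
    have h1 := rpow_absNorm_le_indicator_add hp hPp hs
    have h2 := sq_rpow_absNorm_le hp hPp hs
    linarith
  · rw [(summable_splitSum (F := F) hs).tsum_add
      (summable_nat_rpow_neg_two.mul_left (((discr F).natAbs : ℝ) + 2)), tsum_mul_left, splitSum]
    ring

/-- The zeta function has a simple pole at 1 with nonzero residue. -/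
theorem exists_abs_log_idealZeta_add_log_le (F : Type*) [Field F] [NumberField F] :
    ∃ C : ℝ, ∀ᶠ s : ℝ in 𝓝[>] 1, |Real.log (idealZeta F s) + Real.log (s - 1)| ≤ C := by
  have h := (tendsto_sub_one_mul_idealZeta (F := F)).log (dedekindZeta_residue_ne_zero F)
  refine ⟨|Real.log (dedekindZeta_residue F)| + 1, ?_⟩
  filter_upwards [h.abs.eventually_le_const (lt_add_one _), self_mem_nhdsWithin] with s hs hs1
  have hs1' : 1 < s := hs1
  rwa [Real.log_mul (by linarith) (idealZeta_pos hs1').ne', add_comm] at hs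

theorem tendsto_neg_log_sub_one :
    Tendsto (fun s : ℝ => -Real.log (s - 1)) (𝓝[>] 1) atTop := by
  refine tendsto_neg_atBot_atTop.comp (Real.tendsto_log_nhdsGT_zero.comp ?_)
  refine tendsto_nhdsWithin_iff.2 ⟨?_, ?_⟩
  · have : Tendsto (fun s : ℝ => s - 1) (𝓝 1) (𝓝 (1 - 1)) := tendsto_id.sub_const 1
    rw [sub_self] at this
    exact this.mono_left nhdsWithin_le_nhds
  · filter_upwards [self_mem_nhdsWithin] with s hs
    exact sub_pos.2 (Set.mem_Ioi.1 hs)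

theorem exists_neg_log_le_finrank_mul_splitSum (F : Type*) [Field F] [NumberField F]
    [IsGalois ℚ F] : ∃ C : ℝ, ∀ᶠ s : ℝ in 𝓝[>] 1,
      -Real.log (s - 1) ≤ Module.finrank ℚ F * splitSum F s + C := by
  obtain ⟨C, hC⟩ := log_idealZeta_le (F := F)
  obtain ⟨C', hC'⟩ := exists_abs_log_idealZeta_add_log_le F
  refine ⟨C + C', ?_⟩
  filter_upwards [hC', self_mem_nhdsWithin] with s hs hs1
  have := (abs_le.1 hs).1
  linarith [hC s hs1]

theorem exists_finrank_mul_splitSum_le_neg_log (F : Type*) [Field F] [NumberField F] :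
    ∃ C : ℝ, ∀ᶠ s : ℝ in 𝓝[>] 1,
      Module.finrank ℚ F * splitSum F s ≤ -Real.log (s - 1) + C := by
  obtain ⟨C', hC'⟩ := exists_abs_log_idealZeta_add_log_le F
  refine ⟨Module.finrank ℚ F * ∑' n : ℕ, (n : ℝ) ^ (-2 : ℝ) + C', ?_⟩
  filter_upwards [hC', self_mem_nhdsWithin] with s hs hs1
  have := (abs_le.1 hs).2
  linarith [finrank_mul_splitSum_le (F := F) hs1]

theorem exists_splitsCompletely (F : Type*) [Field F] [NumberField F] [IsGalois ℚ F] :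
    ∃ p : ℕ, p.Prime ∧ SplitsCompletely F p := by
  by_contra! h
  have hzero : ∀ s, splitSum F s = 0 := fun s => by
    rw [splitSum, show {p : ℕ | p.Prime ∧ SplitsCompletely F p} = ∅ from
      Set.eq_empty_of_forall_notMem fun p hp => h p hp.1 hp.2]
    simp
  obtain ⟨C, hC⟩ := exists_neg_log_le_finrank_mul_splitSum F
  obtain ⟨s, hs, hs'⟩ := (hC.and (tendsto_neg_log_sub_one.eventually_gt_atTop C)).exists
  rw [hzero] at hs
  linarith

/-- If almost all primes that split completely in the Galois number field `F` split completely
in `M`, then the degree of `M` is at most that of `F`. -/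
theorem finrank_le_of_splitsCompletely (F M : Type*) [Field F] [NumberField F] [IsGalois ℚ F]
    [Field M] [NumberField M] {N : ℕ} (hN : N ≠ 0)
    (h : ∀ p : ℕ, p.Prime → ¬ p ∣ N → SplitsCompletely F p → SplitsCompletely M p) :
    Module.finrank ℚ M ≤ Module.finrank ℚ F := by
  by_contra! hlt
  obtain ⟨C₁, h₁⟩ := exists_neg_log_le_finrank_mul_splitSum F
  obtain ⟨C₂, h₂⟩ := exists_finrank_mul_splitSum_le_neg_log M
  set n : ℝ := (Module.finrank ℚ F : ℝ)
  set m : ℝ := (Module.finrank ℚ M : ℝ)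
  have hn : 0 < n := Nat.cast_pos.2 Module.finrank_pos
  have hm : n + 1 ≤ m := Nat.cast_add_one (R := ℝ) _ ▸ Nat.cast_le.2 hlt
  set c : ℝ := (N.divisors.card : ℝ)
  -- Eliminating both split sums gives `(m - n) * L ≤ n * (m * c + C₂) + m * C₁`; as `m - n ≥ 1`, a
  -- larger `L` is a contradiction.
  obtain ⟨s, hs1, hs2, hs3, hs⟩ := (h₁.and (h₂.and ((tendsto_neg_log_sub_one.eventually_gt_atTop
    (max (n * (m * c + C₂) + m * C₁) 0)).and (self_mem_nhdsWithin)))).exists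
  have hle : splitSum F s ≤ splitSum M s + c := splitSum_le_add_card hN h hs
  set L := -Real.log (s - 1)
  obtain ⟨hL, hL0⟩ := max_lt_iff.1 hs3
  have e1 := mul_le_mul_of_nonneg_left hs1 (by linarith : 0 ≤ m)
  have e2 := mul_le_mul_of_nonneg_left hs2 hn.le
  have e3 := mul_le_mul_of_nonneg_left hle (mul_nonneg (by linarith) hn.le : 0 ≤ m * n)
  have e4 : (n + 1) * L ≤ m * L := mul_le_mul_of_nonneg_right hm hL0.le
  nlinarith

end SplitSum

/-! ### Comparison of the Galois closures -/

section NormalClosure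

theorem isGalois_normalClosure (K Ω : Type*) [Field K] [NumberField K] [Field Ω] [CharZero Ω]
    [IsAlgClosed Ω] : IsGalois ℚ (IntermediateField.normalClosure ℚ K Ω) :=
  have : IsNormalClosure ℚ K (IntermediateField.normalClosure ℚ K Ω) :=
    Algebra.IsAlgebraic.isNormalClosure_normalClosure fun _ => IsAlgClosed.splits _
  have := IsNormalClosure.normal (F := ℚ) (K := K) (L := IntermediateField.normalClosure ℚ K Ω)
  IsGalois.mk

/-- At a prime split in the Galois closure of `K`, the count for `K` reaches `[K:ℚ]`, while that for
`L` never exceeds `[L:ℚ]`. -/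
theorem finrank_le_of_idealCount_eq {K L : Type*} [Field K] [NumberField K] [Field L]
    [NumberField L] (h : ∀ n ≠ 0, idealCount K n = idealCount L n) :
    Module.finrank ℚ K ≤ Module.finrank ℚ L := by
  let N := IntermediateField.normalClosure ℚ K (AlgebraicClosure K)
  have : NumberField N := { to_charZero := inferInstance, to_finiteDimensional := inferInstance }
  have : IsGalois ℚ N := isGalois_normalClosure K _
  obtain ⟨p, hp, hsplit⟩ := exists_splitsCompletely N
  have hK : SplitsCompletely K p := hsplit.of_ringHom hp (algebraMap K N)
  rw [← hK.idealCount_eq hp, h p hp.ne_zero]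
  exact idealCount_le_finrank hp

theorem SplitsCompletely.of_idealCount_eq {K L : Type*} [Field K] [NumberField K] [Field L]
    [NumberField L] (h : ∀ n ≠ 0, idealCount K n = idealCount L n) {p : ℕ} (hp : p.Prime)
    (hK : SplitsCompletely K p) : SplitsCompletely L p := by
  rw [splitsCompletely_iff_idealCount_eq hp] at hK ⊢
  rw [← h p hp.ne_zero, hK]
  exact le_antisymm (finrank_le_of_idealCount_eq h)
    (finrank_le_of_idealCount_eq fun n hn => (h n hn).symm)

theorem RingHom.apply_mem_adjoin_of_range_subset {E M : Type*} [Field E] [NumberField E] [Field M]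
    [NumberField M] (φ : E →+* M) {X : Set (𝓞 M)}
    (hφ : Set.range (RingOfIntegers.mapRingHom φ) ⊆ X) (z : E) :
    φ z ∈ IntermediateField.adjoin ℚ (algebraMap (𝓞 M) M '' X) := by
  obtain ⟨a, b, -, rfl⟩ := IsFractionRing.div_surjective (A := 𝓞 E) z
  rw [map_div₀]
  exact div_mem
    (IntermediateField.subset_adjoin _ _ ⟨_, hφ ⟨a, rfl⟩, rfl⟩)
    (IntermediateField.subset_adjoin _ _ ⟨_, hφ ⟨b, rfl⟩, rfl⟩)

/-- Away from finitely many primes, complete splitting in two number fields implies complete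
splitting in any number field generated by their conjugates. -/
theorem exists_forall_splitsCompletely_of_conjugates (K L M : Type*) [Field K] [NumberField K]
    [Field L] [NumberField L] [Field M] [NumberField M]
    (hgen : IntermediateField.adjoin ℚ
      ((⋃ φ : K →+* M, Set.range φ) ∪ ⋃ φ : L →+* M, Set.range φ) = ⊤) :
    ∃ N : ℕ, N ≠ 0 ∧ ∀ p : ℕ, p.Prime → ¬ p ∣ N → SplitsCompletely K p →
      SplitsCompletely L p → SplitsCompletely M p := by
  set X : Set (𝓞 M) := (⋃ φ : K →+* M, Set.range (RingOfIntegers.mapRingHom φ)) ∪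
    ⋃ φ : L →+* M, Set.range (RingOfIntegers.mapRingHom φ)
  have hX : IntermediateField.adjoin ℚ (algebraMap (𝓞 M) M '' X) = ⊤ := by
    rw [eq_top_iff, ← hgen, IntermediateField.adjoin_le_iff]
    rintro x (hx | hx)
    · obtain ⟨φ, z, rfl⟩ := Set.mem_iUnion.1 hx
      exact φ.apply_mem_adjoin_of_range_subset (fun y hy => Or.inl (Set.mem_iUnion.2 ⟨φ, hy⟩)) z
    · obtain ⟨φ, z, rfl⟩ := Set.mem_iUnion.1 hx
      exact φ.apply_mem_adjoin_of_range_subset (fun y hy => Or.inr (Set.mem_iUnion.2 ⟨φ, hy⟩)) z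
  obtain ⟨N, hN, h⟩ := exists_forall_splitsCompletely_of_adjoin_eq_top hX
  refine ⟨N, hN, fun p hp hpN hK hL => h p hp hpN ?_⟩
  rintro x (hx | hx)
  · obtain ⟨φ, y, rfl⟩ := Set.mem_iUnion.1 hx
    simpa using map_dvd (RingOfIntegers.mapRingHom φ) (hK y)
  · obtain ⟨φ, y, rfl⟩ := Set.mem_iUnion.1 hx
    simpa using map_dvd (RingOfIntegers.mapRingHom φ) (hL y)

theorem adjoin_conjugates_eq_top {K L Ω : Type*} [Field K] [NumberField K] [Field L]
    [NumberField L] [Field Ω] [CharZero Ω] {M : IntermediateField ℚ Ω}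
    (hM : M = IntermediateField.normalClosure ℚ K Ω ⊔ IntermediateField.normalClosure ℚ L Ω) :
    IntermediateField.adjoin ℚ
      ((⋃ φ : K →+* M, Set.range φ) ∪ ⋃ φ : L →+* M, Set.range φ) = ⊤ := by
  set A := IntermediateField.adjoin ℚ
    ((⋃ φ : K →+* M, Set.range φ) ∪ ⋃ φ : L →+* M, Set.range φ)
  -- Every embedding of `K` or `L` into `Ω` lands in `M`, so its image lies in `A` viewed inside
  -- `Ω`.
  have hle : M ≤ IntermediateField.lift A := by
    conv_lhs => rw [hM]
    refine sup_le (iSup_le fun f => ?_) (iSup_le fun f => ?_)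
    · have hf : ∀ z, f z ∈ M := fun z =>
        hM ▸ (le_sup_left (a := IntermediateField.normalClosure ℚ K Ω) : _)
          (f.fieldRange_le_normalClosure ⟨z, rfl⟩)
      rintro _ ⟨z, rfl⟩
      exact (IntermediateField.mem_lift (⟨f z, hf z⟩ : M)).2
        (IntermediateField.subset_adjoin _ _ (Or.inl (Set.mem_iUnion.2
          ⟨(f.toRingHom.codRestrict M hf), z, rfl⟩)))
    · have hf : ∀ z, f z ∈ M := fun z =>
        hM ▸ (le_sup_right (a := IntermediateField.normalClosure ℚ K Ω) : _)
          (f.fieldRange_le_normalClosure ⟨z, rfl⟩)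
      rintro _ ⟨z, rfl⟩
      exact (IntermediateField.mem_lift (⟨f z, hf z⟩ : M)).2
        (IntermediateField.subset_adjoin _ _ (Or.inr (Set.mem_iUnion.2
          ⟨(f.toRingHom.codRestrict M hf), z, rfl⟩)))
  exact eq_top_iff.2 fun x _ => (IntermediateField.mem_lift x).1 (hle x.2)

theorem normalClosure_le_of_idealCount_eq {K L Ω : Type*} [Field K] [NumberField K] [Field L]
    [NumberField L] [Field Ω] [CharZero Ω] [IsAlgClosed Ω]
    (h : ∀ n ≠ 0, idealCount K n = idealCount L n) :
    IntermediateField.normalClosure ℚ L Ω ≤ IntermediateField.normalClosure ℚ K Ω := by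
  set F := IntermediateField.normalClosure ℚ K Ω with hF
  set M := F ⊔ IntermediateField.normalClosure ℚ L Ω with hM
  have : NumberField F := { to_charZero := inferInstance, to_finiteDimensional := inferInstance }
  have : NumberField M := { to_charZero := inferInstance, to_finiteDimensional := inferInstance }
  have : IsGalois ℚ F := isGalois_normalClosure K Ω
  obtain ⟨N, hN, hsplit⟩ :=
    exists_forall_splitsCompletely_of_conjugates K L M (adjoin_conjugates_eq_top hM)
  have f : K →ₐ[ℚ] Ω := IsAlgClosed.lift
  have hf : ∀ z, f z ∈ F := fun z => f.fieldRange_le_normalClosure ⟨z, rfl⟩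
  have hrank := finrank_le_of_splitsCompletely F M hN fun p hp hpN hFp => by
    have hK : SplitsCompletely K p := hFp.of_ringHom hp (f.toRingHom.codRestrict F hf)
    exact hsplit p hp hpN hK (hK.of_idealCount_eq h hp)
  have heq : F = M := IntermediateField.eq_of_le_of_finrank_le le_sup_left hrank
  exact heq ▸ le_sup_right

end NormalClosure

/-- Let `K` and `L` be number fields whose Dedekind zeta functions coincide (on the half-plane
`1 < re s`, where they are given by their Dirichlet series). Then `K` and `L` have the same Galois
closure over `ℚ`: inside every algebraically closed field `Ω` of characteristic zero, the subfield
generated by all conjugates of `K` equals the subfield generated by all conjugates of `L`. -/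
theorem proposition2p3 {K L Ω : Type*} [Field K] [NumberField K] [Field L] [NumberField L]
    [Field Ω] [Algebra ℚ Ω] [IsAlgClosed Ω]
    (hζ : ∀ s : ℂ, 1 < s.re → NumberField.dedekindZeta K s = NumberField.dedekindZeta L s) :
    IntermediateField.normalClosure ℚ K Ω = IntermediateField.normalClosure ℚ L Ω := by
  have : CharZero Ω := algebraRat.charZero Ω
  -- The `ℚ`-algebra structure on `Ω` is unique, so it may be taken to be the canonical one.
  obtain rfl : ‹Algebra ℚ Ω› = DivisionRing.toRatAlgebra := Subsingleton.elim _ _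
  have h : ∀ n ≠ 0, idealCount K n = idealCount L n := fun n hn =>
    idealCount_eq_of_dedekindZeta_eq hζ hn
  exact le_antisymm (normalClosure_le_of_idealCount_eq fun n hn => (h n hn).symm)
    (normalClosure_le_of_idealCount_eq h)
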